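/- Let $L$ be a finite-dimensional nilpotent Lie algebra of class two over a field $k$, and let $L\cong F/R$ be a presentation of $L$, where $F$ is a free Lie algebra over $k$, $\pi:F\to L$ is a surjective homomorphism and $R=\ker\pi$. Write $L^2=[L,L]$, and let $\mathcal M(L)=(R\cap F^2)/[R,F]$ be the Schur multiplier of $L$. Let $K$ be the subspace of $L^2\otimes_k L/L^2$ spanned by all the elements $$[x,y]\otimes(z+L^2)+[z,x]\otimes(y+L^2)+[y,z]\otimes(x+L^2),\qquad x,y,z\in L.$$ Let $M^*=(L/L^2\wedge L/L^2)\oplus\big((L^2\otimes L/L^2)/K\big)$, regarded as an abelian Lie algebra, let $N$ be its summand $(L^2\otimes L/L^2)/K$, and let $\rho:L/L^2\wedge L/L^2\to L^2$ be the homomorphism with $\rho\big((x+L^2)\wedge(y+L^2)\big)=[x,y]$ for all $x,y\in L$. Then: 1. The subalgebra $M=\{(w,n)\in M^*: \rho(w)=0\}$ of $M^*$ contains $N$ and satisfies $M/N\cong\ker\rho$. For this $M$, and for every subalgebra $M$ of $M^*$ that contains $N$ and satisfies $M/N\cong\ker\rho$, there is an isomorphism of Lie algebras $\mathcal M(L)\cong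 M$. 2. There is exactly one linear map $\beta: L^2\otimes_k L/L^2\to\mathcal M(L)$ with $\beta\big(x\otimes(z+L^2)\big)=[\tilde x,\tilde z]+[R,F]$ for all $x\in L^2$, $z\in L$ and all $\tilde x,\tilde z\in F$ with $\pi(\tilde x)=x$ and $\pi(\tilde z)=z$ (such a bracket $[\tilde x,\tilde z]$ always lies in $R\cap F^2$), and $\ker\beta=K$. -/

import Mathlib

open scoped TensorProduct

noncomputable section

namespace ClassTwo

/-! ### Vector spaces as abelian Lie algebras -/

/-- A vector space `V` regarded as an abelian Lie algebra (zero bracket). -/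
def AbelianLie (V : Type*) : Type _ := V

namespace AbelianLie

instance {V : Type*} [AddCommGroup V] : AddCommGroup (AbelianLie V) :=
  inferInstanceAs (AddCommGroup V)

instance {V : Type*} [AddCommGroup V] : LieRing (AbelianLie V) where
  bracket _ _ := 0
  add_lie _ _ _ := (add_zero 0).symm
  lie_add _ _ _ := (add_zero 0).symm
  lie_self _ := rfl
  leibniz_lie _ _ _ := (add_zero 0).symm

instance {k V : Type*} [Field k] [AddCommGroup V] [Module k V] : Module k (AbelianLie V) :=
  inferInstanceAs (Module k V)

instance {k V : Type*} [Field k] [AddCommGroup V] [Module k V] : LieAlgebra k (AbelianLie V) where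
  lie_smul t _ _ := (smul_zero t).symm

/-- The identity map from an abelian Lie algebra to its underlying vector space. -/
def toSpace (k : Type*) {V : Type*} [Field k] [AddCommGroup V] [Module k V] :
    AbelianLie V ≃ₗ[k] V :=
  LinearEquiv.refl k V

theorem lie_eq_zero {V : Type*} [AddCommGroup V] (x y : AbelianLie V) : ⁅x, y⁆ = 0 := rfl

end AbelianLie

/-! ### The derived subalgebra, the abelianization and the Schur multiplier -/

/-- The derived subalgebra `L² = [L, L]`, as an ideal. -/
abbrev derived (k L : Type*) [Field k] [LieRing L] [LieAlgebra k L] : LieIdeal k L :=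
  ⁅(⊤ : LieIdeal k L), (⊤ : LieIdeal k L)⁆

/-- The abelianization `L / L²`. -/
abbrev Ab (k L : Type*) [Field k] [LieRing L] [LieAlgebra k L] : Type _ :=
  L ⧸ derived k L

/-- The class `x + L²`. -/
abbrev toAb (k : Type*) {L : Type*} [Field k] [LieRing L] [LieAlgebra k L] (x : L) : Ab k L :=
  LieSubmodule.Quotient.mk x

/-- For `R = ker π`, with `π : F → L`, the ideal `R ∩ F²` of `F`. -/
abbrev relDerived {k F L : Type*} [Field k] [LieRing F] [LieAlgebra k F] [LieRing L]
    [LieAlgebra k L] (π : F →ₗ⁅k⁆ L) : LieIdeal k F :=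
  π.ker ⊓ derived k F

/-- For `R = ker π`, with `π : F → L`, the ideal `[R, F]`, as an ideal of `R ∩ F²`. -/
abbrev relCommutator {k F L : Type*} [Field k] [LieRing F] [LieAlgebra k F] [LieRing L]
    [LieAlgebra k L] (π : F →ₗ⁅k⁆ L) : LieIdeal k (relDerived π) :=
  LieIdeal.comap (relDerived π).incl ⁅π.ker, (⊤ : LieIdeal k F)⁆

/-- The Schur multiplier `(R ∩ F²) / [R, F]` of `L`, computed from a presentation `L ≅ F / R`
given by a homomorphism `π` from a free Lie algebra `F` onto `L`, with kernel `R`. -/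
abbrev SchurMultiplier {k X L : Type*} [Field k] [LieRing L] [LieAlgebra k L]
    (π : FreeLieAlgebra k X →ₗ⁅k⁆ L) : Type _ :=
  relDerived π ⧸ relCommutator π

/-! ### The subspace `K` -/

section Bracket

variable (k : Type*) {L : Type*} [Field k] [LieRing L] [LieAlgebra k L]

/-- The bracket `[x, y]` as an element of `L²`. -/
def brk (x y : L) : derived k L :=
  ⟨⁅x, y⁆, LieSubmodule.lie_mem_lie (LieSubmodule.mem_top x) (LieSubmodule.mem_top y)⟩

/-- The element `[x,y] ⊗ (z + L²) + [z,x] ⊗ (y + L²) + [y,z] ⊗ (x + L²)` of `L² ⊗ L/L²`. -/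
def jacobiElt (x y z : L) : derived k L ⊗[k] Ab k L :=
  brk k x y ⊗ₜ[k] toAb k z + brk k z x ⊗ₜ[k] toAb k y + brk k y z ⊗ₜ[k] toAb k x

variable (L) in
/-- The subspace `K` of `L² ⊗ L/L²` spanned by the Jacobi-type elements. -/
def jacobiSpan : Submodule k (derived k L ⊗[k] Ab k L) :=
  Submodule.span k {t | ∃ x y z : L, t = jacobiElt k x y z}

/-- The bracket of `L` as a bilinear map to `L²`. -/
def brkLin : L →ₗ[k] L →ₗ[k] derived k L :=
  LinearMap.mk₂ k (brk k)
    (fun _ _ _ => Subtype.ext (add_lie _ _ _)) (fun _ _ _ => Subtype.ext (smul_lie _ _ _))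
    (fun _ _ _ => Subtype.ext (lie_add _ _ _)) (fun _ _ _ => Subtype.ext (lie_smul _ _ _))

/-! ### The homomorphism `ρ` -/

variable {k}

/-- In a Lie algebra of nilpotency class two, `L²` is central. -/
theorem lie_derived_eq_zero (hL : LieModule.nilpotencyLength L L = 2) (x : L) {y : L}
    (hy : y ∈ derived k L) : ⁅x, y⁆ = 0 := by
  have h := ((LieModule.nilpotencyLength_eq_succ_iff k L L 1).1 hL).1
  rw [LieModule.lowerCentralSeries_succ, LieModule.lowerCentralSeries_succ,
    LieModule.lowerCentralSeries_zero] at h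
  have : ⁅x, y⁆ ∈ ⁅(⊤ : LieIdeal k L), derived k L⁆ :=
    LieSubmodule.lie_mem_lie (LieSubmodule.mem_top x) hy
  rw [h] at this
  exact (LieSubmodule.mem_bot _).1 this

/-- The bilinear map `(x + L², y + L²) ↦ [x, y]`. -/
def brkAb (hL : LieModule.nilpotencyLength L L = 2) : Ab k L →ₗ[k] Ab k L →ₗ[k] derived k L :=
  (derived k L).toSubmodule.liftQ
    ({ toFun := fun x => (derived k L).toSubmodule.liftQ (brkLin k x)
        (fun _ hy => Subtype.ext (lie_derived_eq_zero hL x hy))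
       map_add' := fun x x' => Submodule.linearMap_qext _
        (LinearMap.ext fun y => Subtype.ext (add_lie x x' y))
       map_smul' := fun c x => Submodule.linearMap_qext _
        (LinearMap.ext fun y => Subtype.ext (smul_lie c x y)) } :
      L →ₗ[k] Ab k L →ₗ[k] derived k L)
    (fun x hx => by
      refine Submodule.linearMap_qext _ (LinearMap.ext fun y => Subtype.ext ?_)
      change ⁅x, y⁆ = 0
      rw [← lie_skew, lie_derived_eq_zero hL y hx, neg_zero])

theorem brkAb_self (hL : LieModule.nilpotencyLength L L = 2) (v : Ab k L) :
    brkAb hL v v = 0 := by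
  obtain ⟨x, rfl⟩ := Submodule.Quotient.mk_surjective _ v
  exact Subtype.ext (lie_self x)

/-- The alternating bilinear map `(x + L², y + L²) ↦ [x, y]`. -/
def brkAlt (hL : LieModule.nilpotencyLength L L = 2) :
    Ab k L [⋀^Fin 2]→ₗ[k] derived k L where
  toFun v := brkAb hL (v 0) (v 1)
  map_update_add' v i x y := by
    fin_cases i <;> simp [Function.update]
  map_update_smul' v i c x := by
    fin_cases i <;> simp [Function.update]
  map_eq_zero_of_eq' v i j h hij := by
    have h01 : v 0 = v 1 := by
      fin_cases i <;> fin_cases j <;> simp_all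
    rw [h01, brkAb_self]

/-- The homomorphism `ρ : L/L² ∧ L/L² → L²` with `ρ((x + L²) ∧ (y + L²)) = [x, y]`. -/
def rho (hL : LieModule.nilpotencyLength L L = 2) : ⋀[k]^2 (Ab k L) →ₗ[k] derived k L :=
  exteriorPower.alternatingMapLinearEquiv (brkAlt hL)

theorem rho_apply (hL : LieModule.nilpotencyLength L L = 2) (x y : L) :
    rho hL (exteriorPower.ιMulti k 2 ![toAb k x, toAb k y]) = brk k x y := by
  rw [rho, exteriorPower.alternatingMapLinearEquiv_apply_ιMulti]
  rfl

end Bracket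

/-! ### The Lie algebras `M*`, `N` and `M` -/

section Model

variable (k L : Type*) [Field k] [LieRing L] [LieAlgebra k L]

/-- The abelian Lie algebra `M* = (L/L² ∧ L/L²) ⊕ (L² ⊗ L/L²)/K`. -/
abbrev MStar : Type _ :=
  AbelianLie ((⋀[k]^2 (Ab k L)) × ((derived k L ⊗[k] Ab k L) ⧸ jacobiSpan k L))

/-- The projection of `M*` onto its first summand `L/L² ∧ L/L²`. -/
def wedgePart : MStar k L →ₗ[k] ⋀[k]^2 (Ab k L) :=
  LinearMap.fst k _ _ ∘ₗ (AbelianLie.toSpace k).toLinearMap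

/-- The summand `N = (L² ⊗ L/L²)/K` of `M*`: the elements whose first component is zero. -/
def idealN : LieIdeal k (MStar k L) where
  toSubmodule := LinearMap.ker (wedgePart k L)
  lie_mem _ := Submodule.zero_mem _

variable {k L}

/-- The subalgebra `M = ker ρ ⊕ N` of `M*`: the elements whose first component is in `ker ρ`. -/
def modelM (hL : LieModule.nilpotencyLength L L = 2) : LieSubalgebra k (MStar k L) where
  toSubmodule := (LinearMap.ker (rho hL)).comap (wedgePart k L)
  lie_mem' _ _ := Submodule.zero_mem _

/-- `N ⊆ M` and `M / N ≅ ker ρ`, for a subalgebra `M` of `M*`; here `ker ρ`, a subspace of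
`L/L² ∧ L/L²`, has zero bracket. -/
def IsModel (hL : LieModule.nilpotencyLength L L = 2) (M : LieSubalgebra k (MStar k L)) : Prop :=
  (idealN k L).toSubmodule ≤ M.toSubmodule ∧
    Nonempty ((M ⧸ LieIdeal.comap M.incl (idealN k L)) ≃ₗ⁅k⁆
      AbelianLie (LinearMap.ker (rho (k := k) hL)))

end Model

/-! ### The homomorphism `β` -/

/-- The defining property of the homomorphism `β : L² ⊗ L/L² → M(L)`:
`β(x ⊗ (z + L²)) = [x', z'] + [R, F]` for all `x ∈ L²` and `z ∈ L` and all preimages `x'`, `z'`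
of `x`, `z` under `π : F → L` (in particular `[x', z']` lies in `R ∩ F²`). -/
def IsBeta {k X L : Type*} [Field k] [LieRing L] [LieAlgebra k L]
    (π : FreeLieAlgebra k X →ₗ⁅k⁆ L)
    (β : derived k L ⊗[k] Ab k L →ₗ[k] SchurMultiplier π) : Prop :=
  ∀ (x : derived k L) (z : L) (x' z' : FreeLieAlgebra k X), π x' = x → π z' = z →
    ∃ h : ⁅x', z'⁆ ∈ relDerived π,
      β (x ⊗ₜ[k] toAb k z) = LieSubmodule.Quotient.mk ⟨⁅x', z'⁆, h⟩

end ClassTwo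

end

/-! The theorem amounts to a split exact sequence `0 → (L² ⊗ L/L²)/K → M(L) → ker ρ → 0` whose first
map is induced by `β`.

Let `S` be the preimage of `L²` in `F`. Class two gives `[S, F] ⊆ R ∩ F²`, and the Jacobi identity
gives `[S, S] ⊆ [R, F]` (`lie_preDerived_mem`). Hence `[u, v]` with `u ∈ S` depends, modulo `[R,
F]`, only on `π u` and on `π v` modulo `L²`. This defines `β`, whose image is that of `[S, F]`; it
kills `K` by Jacobi in `F`.

Two maps out of `M(L)` control the rest. Both come from 2-cocycles on `L`, which become coboundaries
on a free Lie algebra (`exists_primitive`). The cocycle `(x, y) ↦ x̄ ∧ ȳ` gives `θ`, with kernel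
`range β` and range `ker ρ`. A cocycle extending `x ⊗ ȳ` from `x ∈ L²` to all of `L`, valid exactly
modulo `K`, gives `φ` with `φ ∘ β` the quotient map. So `ker β = K`, and `(θ, φ)` identifies `M(L)`
with `ker ρ ⊕ N` (`exists_schurSplit`).

All algebras compared are abelian, so any other admissible `M` is handled by counting dimensions;
only there is finite dimension needed. -/

noncomputable section

namespace ClassTwo

/-! ### Lie algebras with zero bracket -/

section Abelian

variable {k A B : Type*} [Field k] [LieRing A] [LieAlgebra k A] [LieRing B] [LieAlgebra k B]

/-- A linear equivalence between Lie algebras with zero brackets is an isomorphism of Lie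
algebras. -/
def lieEquivOfAbelian (hA : ∀ x y : A, ⁅x, y⁆ = 0) (hB : ∀ x y : B, ⁅x, y⁆ = 0) (e : A ≃ₗ[k] B) :
    A ≃ₗ⁅k⁆ B :=
  { e with
    map_lie' := fun {x y} => by
      change e ⁅x, y⁆ = ⁅e x, e y⁆
      rw [hA, hB, map_zero] }

theorem quotient_lie_eq_zero (hA : ∀ x y : A, ⁅x, y⁆ = 0) (I : LieIdeal k A) (a b : A ⧸ I) :
    ⁅a, b⁆ = 0 := by
  obtain ⟨x, rfl⟩ := LieSubmodule.Quotient.surjective_mk' I a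
  obtain ⟨y, rfl⟩ := LieSubmodule.Quotient.surjective_mk' I b
  refine (LieSubmodule.Quotient.mk_bracket (I := I) x y).symm.trans ?_
  rw [hA]
  rfl

/-- The first isomorphism theorem for a linear map between spaces with zero bracket. -/
theorem nonempty_quotient_equiv {V : Type*} [AddCommGroup V] [Module k V]
    (hA : ∀ x y : A, ⁅x, y⁆ = 0) (I : LieIdeal k A) (f : A →ₗ[k] V)
    (hf : Function.Surjective f) (hI : ∀ x, x ∈ I ↔ f x = 0) :
    Nonempty ((A ⧸ I) ≃ₗ⁅k⁆ AbelianLie V) :=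
  ⟨lieEquivOfAbelian (quotient_lie_eq_zero hA I) AbelianLie.lie_eq_zero
    ((Submodule.quotEquivOfEq I.toSubmodule (LinearMap.ker f) (Submodule.ext hI)).trans
      ((f.quotKerEquivOfSurjective hf).trans (AbelianLie.toSpace k).symm))⟩

end Abelian

/-! ### Derived subalgebra and abelianization -/

section Derived

variable {k L : Type*} [Field k] [LieRing L] [LieAlgebra k L]

theorem lie_mem_derived (x y : L) : ⁅x, y⁆ ∈ derived k L :=
  LieSubmodule.lie_mem_lie (LieSubmodule.mem_top x) (LieSubmodule.mem_top y)

/-- A subspace that contains every bracket contains the derived subalgebra. -/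
theorem derived_le {S : Submodule k L} (h : ∀ x y : L, ⁅x, y⁆ ∈ S) {w : L}
    (hw : w ∈ derived k L) : w ∈ S := by
  have hw' : w ∈ (derived k L).toSubmodule := hw
  rw [LieSubmodule.lieIdeal_oper_eq_linear_span'] at hw'
  refine Submodule.span_le.2 ?_ hw'
  rintro _ ⟨x, -, y, -, rfl⟩
  exact h x y

variable (k L) in
/-- The projection `L → L/L²` as a linear map. -/
def abMap : L →ₗ[k] Ab k L := (derived k L).toSubmodule.mkQ

theorem abMap_surjective : Function.Surjective (abMap k L) :=
  Submodule.mkQ_surjective _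

theorem abMap_eq_zero {x : L} : abMap k L x = 0 ↔ x ∈ derived k L :=
  Submodule.Quotient.mk_eq_zero _

theorem abMap_lie (x y : L) : abMap k L ⁅x, y⁆ = 0 :=
  abMap_eq_zero.2 (lie_mem_derived x y)

end Derived

/-! ### Cocycles on a free Lie algebra -/

section Cocycle

variable {k L V : Type*} [Field k] [LieRing L] [LieAlgebra k L] [AddCommGroup V] [Module k V]

/-- A `2`-cocycle of `L` with trivial coefficients becomes a coboundary on a free Lie algebra
mapping to `L`. -/
theorem exists_primitive {X : Type*} (π : FreeLieAlgebra k X →ₗ⁅k⁆ L) (c : L →ₗ[k] L →ₗ[k] V)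
    (halt : ∀ x, c x x = 0)
    (hjac : ∀ x y z, c ⁅x, y⁆ z + c ⁅z, x⁆ y + c ⁅y, z⁆ x = 0) :
    ∃ φ : FreeLieAlgebra k X →ₗ[k] V, ∀ u v, φ ⁅u, v⁆ = c (π u) (π v) := by
  have hskew : ∀ x y, c x y = -c y x := fun x y => by
    have h := halt (x + y)
    simp only [map_add, LinearMap.add_apply, halt, zero_add, add_zero] at h
    exact eq_neg_of_add_eq_zero_right h
  -- The central extension of `L` by `V` defined by `c`; the Leibniz rule in the second coordinate
  -- is the cocycle identity.
  let _ : LieRing (L × V) :=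
    { bracket := fun p q => (⁅p.1, q.1⁆, c p.1 q.1)
      add_lie := fun p q r => Prod.ext (add_lie _ _ _) (by
        change c (p.1 + q.1) r.1 = c p.1 r.1 + c q.1 r.1
        rw [map_add, LinearMap.add_apply])
      lie_add := fun p q r => Prod.ext (lie_add _ _ _) (map_add (c p.1) q.1 r.1)
      lie_self := fun p => Prod.ext (lie_self _) (halt _)
      leibniz_lie := fun p q r => Prod.ext (leibniz_lie _ _ _) (by
        change c p.1 ⁅q.1, r.1⁆ = c ⁅p.1, q.1⁆ r.1 + c q.1 ⁅p.1, r.1⁆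
        have h := hjac p.1 q.1 r.1
        rw [hskew p.1, hskew q.1, ← lie_skew p.1 r.1, map_neg, LinearMap.neg_apply, neg_neg]
        exact neg_eq_of_add_eq_zero_left h) }
  let _ : LieAlgebra k (L × V) :=
    { (inferInstance : Module k (L × V)) with
      lie_smul := fun t p q => Prod.ext (lie_smul t _ _) (map_smul (c p.1) t q.1) }
  -- Freeness lifts `π` to the extension. The values in `V` on generators are arbitrary, so 0 is
  -- taken; the `V`-coordinate of the lift is the primitive.
  let Φ : FreeLieAlgebra k X →ₗ⁅k⁆ (L × V) :=
    FreeLieAlgebra.lift k fun x => (π (FreeLieAlgebra.of k x), 0)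
  let pr : (L × V) →ₗ⁅k⁆ L := { LinearMap.fst k L V with map_lie' := rfl }
  have hΦ : pr.comp Φ = π := FreeLieAlgebra.hom_ext fun x => by
    change (Φ (FreeLieAlgebra.of k x)).1 = _
    simp only [Φ, FreeLieAlgebra.lift_of_apply]
  have hΦ' : ∀ u, (Φ u).1 = π u := fun u => DFunLike.congr_fun hΦ u
  refine ⟨LinearMap.snd k L V ∘ₗ (Φ : FreeLieAlgebra k X →ₗ[k] (L × V)), fun u v => ?_⟩
  change (Φ ⁅u, v⁆).2 = _
  rw [LieHom.map_lie, ← hΦ' u, ← hΦ' v]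
  rfl

end Cocycle

/-! ### The exterior square -/

section Maps

variable (k L : Type*) [Field k] [LieRing L] [LieAlgebra k L]

theorem update_pair_zero {A : Type*} (a b c : A) : Function.update ![a, b] 0 c = ![c, b] := by
  ext i
  fin_cases i <;> rfl

theorem update_pair_one {A : Type*} (a b c : A) : Function.update ![a, b] 1 c = ![a, c] := by
  ext i
  fin_cases i <;> rfl

/-- The exterior product `A × A → A ∧ A` as a bilinear map. -/
def wedge (k A : Type*) [Field k] [AddCommGroup A] [Module k A] : A →ₗ[k] A →ₗ[k] ⋀[k]^2 A :=
  LinearMap.mk₂ k (fun a b => exteriorPower.ιMulti k 2 ![a, b])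
    (fun a a' b => by
      have h := (exteriorPower.ιMulti k 2 (M := A)).map_update_add ![a, b] 0 a a'
      rwa [update_pair_zero, update_pair_zero, update_pair_zero] at h)
    (fun t a b => by
      have h := (exteriorPower.ιMulti k 2 (M := A)).map_update_smul ![a, b] 0 t a
      rwa [update_pair_zero, update_pair_zero] at h)
    (fun a b b' => by
      have h := (exteriorPower.ιMulti k 2 (M := A)).map_update_add ![a, b] 1 b b'
      rwa [update_pair_one, update_pair_one, update_pair_one] at h)
    (fun t a b => by
      have h := (exteriorPower.ιMulti k 2 (M := A)).map_update_smul ![a, b] 1 t b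
      rwa [update_pair_one, update_pair_one] at h)

theorem wedge_apply {A : Type*} [AddCommGroup A] [Module k A] (a b : A) :
    wedge k A a b = exteriorPower.ιMulti k 2 ![a, b] := rfl

theorem wedge_self {A : Type*} [AddCommGroup A] [Module k A] (a : A) : wedge k A a a = 0 :=
  (exteriorPower.ιMulti k 2).map_eq_zero_of_eq ![a, a] (i := 0) (j := 1) rfl (by decide)

theorem span_wedge (A : Type*) [AddCommGroup A] [Module k A] :
    Submodule.span k {t | ∃ a b : A, t = wedge k A a b} = ⊤ := by
  rw [eq_top_iff, ← exteriorPower.ιMulti_span k 2 A]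
  refine Submodule.span_mono ?_
  rintro _ ⟨v, rfl⟩
  refine ⟨v 0, v 1, ?_⟩
  rw [wedge_apply]
  congr 1
  ext i
  fin_cases i <;> rfl

/-- An alternating bilinear map factors through the exterior square. -/
theorem exists_wedge_lift {A V : Type*} [AddCommGroup A] [Module k A] [AddCommGroup V] [Module k V]
    (c : A →ₗ[k] A →ₗ[k] V) (halt : ∀ a, c a a = 0) :
    ∃ γ : ⋀[k]^2 A →ₗ[k] V, ∀ a b, γ (wedge k A a b) = c a b := by
  let f : A [⋀^Fin 2]→ₗ[k] V :=
    { toFun := fun v => c (v 0) (v 1)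
      map_update_add' := fun v i x y => by fin_cases i <;> simp [Function.update]
      map_update_smul' := fun v i t x => by fin_cases i <;> simp [Function.update]
      map_eq_zero_of_eq' := fun v i j h hij => by
        have h01 : v 0 = v 1 := by
          fin_cases i <;> fin_cases j <;> simp_all
        rw [h01, halt] }
  refine ⟨exteriorPower.alternatingMapLinearEquiv f, fun a b => ?_⟩
  rw [wedge_apply, exteriorPower.alternatingMapLinearEquiv_apply_ιMulti]
  rfl

variable {k L}

theorem rho_wedge (hL : LieModule.nilpotencyLength L L = 2) (x y : L) :
    rho hL (wedge k (Ab k L) (abMap k L x) (abMap k L y)) = brk k x y :=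
  rho_apply hL x y

end Maps

/-! ### Brackets modulo `[R, F]` -/

section Presentation

variable {k X L : Type*} [Field k] [LieRing L] [LieAlgebra k L]
  (π : FreeLieAlgebra k X →ₗ⁅k⁆ L)

/-- The preimage of `L²` in `F`. -/
abbrev preDerived : LieIdeal k (FreeLieAlgebra k X) := LieIdeal.comap π (derived k L)

theorem mem_preDerived {u : FreeLieAlgebra k X} : u ∈ preDerived π ↔ π u ∈ derived k L :=
  LieIdeal.mem_comap

variable {π}

theorem mem_ker_iff {u : FreeLieAlgebra k X} : u ∈ π.ker ↔ π u = 0 := LieHom.mem_ker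

theorem lie_mem_relDerived (hL : LieModule.nilpotencyLength L L = 2) {u : FreeLieAlgebra k X}
    (hu : u ∈ preDerived π) (v : FreeLieAlgebra k X) : ⁅u, v⁆ ∈ relDerived π := by
  refine ⟨?_, lie_mem_derived u v⟩
  change ⁅u, v⁆ ∈ π.ker
  rw [mem_ker_iff, LieHom.map_lie, ← lie_skew,
    lie_derived_eq_zero hL _ ((mem_preDerived π).1 hu), neg_zero]

theorem lie_mem_relComm {u : FreeLieAlgebra k X} (hu : π u = 0) (v : FreeLieAlgebra k X) :
    ⁅u, v⁆ ∈ ⁅π.ker, (⊤ : LieIdeal k (FreeLieAlgebra k X))⁆ :=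
  LieSubmodule.lie_mem_lie (mem_ker_iff.2 hu) (LieSubmodule.mem_top v)

theorem lie_mem_relComm' {v : FreeLieAlgebra k X} (hv : π v = 0) (u : FreeLieAlgebra k X) :
    ⁅u, v⁆ ∈ ⁅π.ker, (⊤ : LieIdeal k (FreeLieAlgebra k X))⁆ := by
  rw [← lie_skew]
  exact neg_mem (lie_mem_relComm hv u)

theorem exists_derived_lift (hπ : Function.Surjective π) {x : L} (hx : x ∈ derived k L) :
    ∃ d ∈ derived k (FreeLieAlgebra k X), π d = x := by
  refine derived_le (S := (derived k (FreeLieAlgebra k X)).toSubmodule.map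
    (π : FreeLieAlgebra k X →ₗ[k] L)) (fun y z => ?_) hx
  obtain ⟨y, rfl⟩ := hπ y
  obtain ⟨z, rfl⟩ := hπ z
  exact ⟨⁅y, z⁆, lie_mem_derived y z, LieHom.map_lie π y z⟩

/-- The preimage `S` of `L²` in `F` satisfies `[S, S] ⊆ [R, F]`. -/
theorem lie_preDerived_mem (hL : LieModule.nilpotencyLength L L = 2) (hπ : Function.Surjective π)
    {u v : FreeLieAlgebra k X} (hu : u ∈ preDerived π) (hv : v ∈ preDerived π) :
    ⁅u, v⁆ ∈ ⁅π.ker, (⊤ : LieIdeal k (FreeLieAlgebra k X))⁆ := by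
  -- Modulo `R`, `v` may be replaced by an element `d` of `F²`. On a bracket `d = [a, b]`, the
  -- Leibniz rule leaves `[u, a]` and `[u, b]`, both in `R` because `π u` is central.
  obtain ⟨d, hd, hdv⟩ := exists_derived_lift hπ ((mem_preDerived π).1 hv)
  have hR : ∀ a, π ⁅u, a⁆ = 0 := fun a => mem_ker_iff.1 (lie_mem_relDerived hL hu a).1
  have h1 : ⁅u, d⁆ ∈ ⁅π.ker, (⊤ : LieIdeal k (FreeLieAlgebra k X))⁆ := by
    refine derived_le (S := (⁅π.ker, (⊤ : LieIdeal k (FreeLieAlgebra k X))⁆).toSubmodule.comap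
      (LieAlgebra.ad k (FreeLieAlgebra k X) u)) (fun a b => ?_) hd
    change ⁅u, ⁅a, b⁆⁆ ∈ ⁅π.ker, (⊤ : LieIdeal k (FreeLieAlgebra k X))⁆
    rw [leibniz_lie]
    exact add_mem (lie_mem_relComm (hR a) b) (lie_mem_relComm' (hR b) a)
  have h2 : ⁅u, v - d⁆ ∈ ⁅π.ker, (⊤ : LieIdeal k (FreeLieAlgebra k X))⁆ :=
    lie_mem_relComm' (by rw [map_sub, hdv, sub_self]) u
  have h := add_mem h1 h2
  rwa [← lie_add, add_sub_cancel] at h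

variable (π) in
/-- The projection `R ∩ F² → M(L)` as a linear map. -/
def schurMk : relDerived π →ₗ[k] SchurMultiplier π := (relCommutator π).toSubmodule.mkQ

theorem schurMk_surjective : Function.Surjective (schurMk π) := Submodule.mkQ_surjective _

theorem schurMk_eq_zero {w : relDerived π} :
    schurMk π w = 0 ↔ (w : FreeLieAlgebra k X) ∈
      ⁅π.ker, (⊤ : LieIdeal k (FreeLieAlgebra k X))⁆ :=
  (Submodule.Quotient.mk_eq_zero _).trans LieIdeal.mem_comap

theorem schurMk_eq_iff {w w' : relDerived π} :
    schurMk π w = schurMk π w' ↔ (w : FreeLieAlgebra k X) - w' ∈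
      ⁅π.ker, (⊤ : LieIdeal k (FreeLieAlgebra k X))⁆ := by
  rw [← sub_eq_zero, ← map_sub, schurMk_eq_zero]
  rfl

theorem schur_lie_eq_zero (a b : SchurMultiplier π) : ⁅a, b⁆ = 0 := by
  obtain ⟨x, rfl⟩ := schurMk_surjective a
  obtain ⟨y, rfl⟩ := schurMk_surjective b
  refine (LieSubmodule.Quotient.mk_bracket (I := relCommutator π) x y).symm.trans (schurMk_eq_zero.2 ?_)
  exact lie_mem_relComm (mem_ker_iff.1 x.2.1) _

/-- A linear map on `F` that vanishes on the brackets `[r, v]` with `r ∈ R` descends to `M(L)`. -/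
theorem exists_schur_lift {V : Type*} [AddCommGroup V] [Module k V]
    (φ : FreeLieAlgebra k X →ₗ[k] V) (h : ∀ u v, π u = 0 → φ ⁅u, v⁆ = 0) :
    ∃ ψ : SchurMultiplier π →ₗ[k] V, ∀ w : relDerived π, ψ (schurMk π w) = φ w := by
  refine ⟨(relCommutator π).toSubmodule.liftQ (φ ∘ₗ (relDerived π).toSubmodule.subtype) ?_,
    fun w => rfl⟩
  intro w hw
  have hw' : (w : FreeLieAlgebra k X) ∈
      (⁅π.ker, (⊤ : LieIdeal k (FreeLieAlgebra k X))⁆).toSubmodule := LieIdeal.mem_comap.1 hw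
  rw [LieSubmodule.lieIdeal_oper_eq_linear_span'] at hw'
  have hle : Submodule.span k {m | ∃ x ∈ π.ker, ∃ n ∈ (⊤ : LieIdeal k (FreeLieAlgebra k X)),
      ⁅x, n⁆ = m} ≤ LinearMap.ker φ := by
    refine Submodule.span_le.2 ?_
    rintro _ ⟨x, hx, y, -, rfl⟩
    exact h x y (mem_ker_iff.1 hx)
  exact hle hw'

/-! ### Construction and uniqueness of `β` -/

/-- Linear sections of `π` and of `L → L/L²` make the bracket of lifts visibly bilinear;
independence of the lifts is then checked afterwards. -/
theorem exists_isBeta (hL : LieModule.nilpotencyLength L L = 2) (hπ : Function.Surjective π) :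
    ∃ β : derived k L ⊗[k] Ab k L →ₗ[k] SchurMultiplier π, IsBeta π β := by
  obtain ⟨σ, hσ⟩ := LinearMap.exists_rightInverse_of_surjective
    (π : FreeLieAlgebra k X →ₗ[k] L) (LinearMap.range_eq_top.2 hπ)
  obtain ⟨τ, hτ⟩ := LinearMap.exists_rightInverse_of_surjective
    (abMap k L) (LinearMap.range_eq_top.2 abMap_surjective)
  have hσ' : ∀ x, π (σ x) = x := fun x => LinearMap.congr_fun hσ x
  have hτ' : ∀ a, abMap k L (τ a) = a := fun a => LinearMap.congr_fun hτ a
  have hmem : ∀ x : derived k L, σ x ∈ preDerived π := fun x => by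
    rw [mem_preDerived, hσ']
    exact x.2
  let B : derived k L →ₗ[k] Ab k L →ₗ[k] relDerived π :=
    LinearMap.mk₂ k (fun x a => ⟨⁅σ x, σ (τ a)⁆, lie_mem_relDerived hL (hmem x) _⟩)
      (fun x x' a => Subtype.ext (by
        change ⁅σ ((x : L) + x'), σ (τ a)⁆ = ⁅σ x, σ (τ a)⁆ + ⁅σ x', σ (τ a)⁆
        rw [map_add, add_lie]))
      (fun t x a => Subtype.ext (by
        change ⁅σ (t • (x : L)), σ (τ a)⁆ = t • ⁅σ x, σ (τ a)⁆
        rw [map_smul, smul_lie]))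
      (fun x a a' => Subtype.ext (by
        change ⁅σ x, σ (τ (a + a'))⁆ = ⁅σ x, σ (τ a)⁆ + ⁅σ x, σ (τ a')⁆
        rw [map_add, map_add, lie_add]))
      (fun t x a => Subtype.ext (by
        change ⁅σ x, σ (τ (t • a))⁆ = t • ⁅σ x, σ (τ a)⁆
        rw [map_smul, map_smul, lie_smul]))
  refine ⟨TensorProduct.lift (B.compr₂ (schurMk π)), ?_⟩
  rintro x z x' z' hx rfl
  have hx' : x' ∈ preDerived π := by
    rw [mem_preDerived, hx]
    exact x.2
  refine ⟨lie_mem_relDerived hL hx' z', ?_⟩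
  rw [TensorProduct.lift.tmul]
  change schurMk π (B x (toAb k (π z'))) = schurMk π ⟨⁅x', z'⁆, _⟩
  rw [schurMk_eq_iff]
  change ⁅σ x, σ (τ (abMap k L (π z')))⁆ - ⁅x', z'⁆ ∈ _
  -- The first term has its left entry in `R`; in the second both entries lie in `S`, where `[S, S]
  -- ⊆ [R, F]` applies.
  have e : ⁅σ x, σ (τ (abMap k L (π z')))⁆ - ⁅x', z'⁆ =
      ⁅σ x - x', z'⁆ + ⁅σ x, σ (τ (abMap k L (π z'))) - z'⁆ := by
    rw [sub_lie, lie_sub]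
    abel
  rw [e]
  refine add_mem (lie_mem_relComm (by rw [map_sub, hσ', hx, sub_self]) _)
    (lie_preDerived_mem hL hπ (hmem x) ?_)
  rw [mem_preDerived, map_sub, hσ', ← abMap_eq_zero, map_sub, hτ', sub_self]

theorem IsBeta.unique (hπ : Function.Surjective π)
    {β β' : derived k L ⊗[k] Ab k L →ₗ[k] SchurMultiplier π} (h : IsBeta π β) (h' : IsBeta π β') :
    β = β' := by
  refine TensorProduct.ext' fun x a => ?_
  obtain ⟨z, rfl⟩ := abMap_surjective a
  obtain ⟨x', hx⟩ := hπ x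
  obtain ⟨z', hz⟩ := hπ z
  obtain ⟨_, e⟩ := h x z x' z' hx hz
  obtain ⟨_, e'⟩ := h' x z x' z' hx hz
  exact e.trans e'.symm

theorem IsBeta.apply {β : derived k L ⊗[k] Ab k L →ₗ[k] SchurMultiplier π} (h : IsBeta π β)
    (hL : LieModule.nilpotencyLength L L = 2) {u : FreeLieAlgebra k X} (hu : u ∈ preDerived π)
    (v : FreeLieAlgebra k X) :
    β (⟨π u, (mem_preDerived π).1 hu⟩ ⊗ₜ[k] abMap k L (π v)) =
      schurMk π ⟨⁅u, v⁆, lie_mem_relDerived hL hu v⟩ :=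
  (h ⟨π u, (mem_preDerived π).1 hu⟩ (π v) u v rfl rfl).2

/-- `β` maps `K` to zero, by the Jacobi identity in `F`. -/
theorem IsBeta.jacobiSpan_le {β : derived k L ⊗[k] Ab k L →ₗ[k] SchurMultiplier π}
    (h : IsBeta π β) (hπ : Function.Surjective π) : jacobiSpan k L ≤ LinearMap.ker β := by
  refine Submodule.span_le.2 ?_
  rintro _ ⟨x, y, z, rfl⟩
  obtain ⟨x, rfl⟩ := hπ x
  obtain ⟨y, rfl⟩ := hπ y
  obtain ⟨z, rfl⟩ := hπ z
  have key : ∀ u v w : FreeLieAlgebra k X, ∃ hm : ⁅⁅u, v⁆, w⁆ ∈ relDerived π,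
      β (brk k (π u) (π v) ⊗ₜ[k] toAb k (π w)) = schurMk π ⟨⁅⁅u, v⁆, w⁆, hm⟩ := fun u v w =>
    h (brk k (π u) (π v)) (π w) ⁅u, v⁆ w (LieHom.map_lie π u v) rfl
  obtain ⟨_, e1⟩ := key x y z
  obtain ⟨_, e2⟩ := key z x y
  obtain ⟨_, e3⟩ := key y z x
  change β (jacobiElt k (π x) (π y) (π z)) = 0
  rw [jacobiElt, map_add, map_add, e1, e2, e3, ← map_add, ← map_add, schurMk_eq_zero]
  change ⁅⁅x, y⁆, z⁆ + ⁅⁅z, x⁆, y⁆ + ⁅⁅y, z⁆, x⁆ ∈ _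
  have e : ⁅⁅x, y⁆, z⁆ + ⁅⁅z, x⁆, y⁆ + ⁅⁅y, z⁆, x⁆ = 0 := by
    have := lie_jacobi x y z
    rw [← lie_skew z ⁅x, y⁆, ← lie_skew y ⁅z, x⁆, ← lie_skew x ⁅y, z⁆] at this
    rw [← neg_eq_zero, ← this]
    abel
  rw [e]
  exact zero_mem _

/-! ### The maps `φ` and `θ` out of `F` -/

variable (π) in
/-- The homomorphism `F → (L² ⊗ L/L²)/K` that sends `[u, v]` to `π u ⊗ (π v + L²)` for
`π u ∈ L²`. -/
theorem exists_tensorMap :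
    ∃ φ : FreeLieAlgebra k X →ₗ[k] (derived k L ⊗[k] Ab k L) ⧸ jacobiSpan k L,
      (∀ u v, π u = 0 → φ ⁅u, v⁆ = 0) ∧
      ∀ (u v : FreeLieAlgebra k X) (hu : u ∈ preDerived π), φ ⁅u, v⁆ =
        (jacobiSpan k L).mkQ (⟨π u, (mem_preDerived π).1 hu⟩ ⊗ₜ[k] abMap k L (π v)) := by
  -- A linear projection `p : L → L²` extends `x ⊗ ȳ` to the alternating form `p x ⊗ ȳ - p y ⊗ x̄`.
  -- For `x ∈ L²` the second term vanishes since `x̄ = 0`, so the cocycle identity asks precisely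
  -- that the Jacobi elements be zero.
  obtain ⟨p, hp⟩ := LinearMap.exists_leftInverse_of_injective
    (derived k L).toSubmodule.subtype (Submodule.ker_subtype _)
  have hp' : ∀ x : derived k L, p x = x := fun x => LinearMap.congr_fun hp x
  let f : L →ₗ[k] L →ₗ[k] derived k L ⊗[k] Ab k L :=
    (TensorProduct.mk k (derived k L) (Ab k L)).compl₁₂ p (abMap k L)
  let c : L →ₗ[k] L →ₗ[k] (derived k L ⊗[k] Ab k L) ⧸ jacobiSpan k L :=
    (f - f.flip).compr₂ (jacobiSpan k L).mkQ
  have hc : ∀ x y, c x y =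
      (jacobiSpan k L).mkQ (p x ⊗ₜ[k] abMap k L y - p y ⊗ₜ[k] abMap k L x) := fun _ _ => rfl
  have hcd : ∀ (x : derived k L) (y : L),
      c x y = (jacobiSpan k L).mkQ (x ⊗ₜ[k] abMap k L y) := fun x y => by
    rw [hc, hp', abMap_eq_zero.2 x.2, TensorProduct.tmul_zero, sub_zero]
  obtain ⟨φ, hφ⟩ := exists_primitive π c (fun x => by rw [hc, sub_self, map_zero])
    (fun x y z => by
      rw [show ⁅x, y⁆ = (brk k x y : L) from rfl, show ⁅z, x⁆ = (brk k z x : L) from rfl,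
        show ⁅y, z⁆ = (brk k y z : L) from rfl, hcd, hcd, hcd, ← map_add, ← map_add]
      exact (Submodule.Quotient.mk_eq_zero _).2 (Submodule.subset_span ⟨x, y, z, rfl⟩))
  refine ⟨φ, fun u v hu => by rw [hφ, hu, map_zero, LinearMap.zero_apply], fun u v hu => ?_⟩
  rw [hφ]
  exact hcd ⟨π u, _⟩ (π v)

variable (π) in
/-- The homomorphism `F → L/L² ∧ L/L²` that sends `[u, v]` to `(π u + L²) ∧ (π v + L²)`. -/
theorem exists_wedgeMap :
    ∃ θ : FreeLieAlgebra k X →ₗ[k] ⋀[k]^2 (Ab k L),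
      ∀ u v, θ ⁅u, v⁆ = wedge k (Ab k L) (abMap k L (π u)) (abMap k L (π v)) := by
  refine exists_primitive π ((wedge k (Ab k L)).compl₁₂ (abMap k L) (abMap k L))
    (fun x => wedge_self k _) fun x y z => ?_
  -- Each term of the cocycle identity has a bracket as an entry, and brackets die in `L/L²`.
  simp only [LinearMap.compl₁₂_apply, abMap_lie, map_zero, LinearMap.zero_apply, add_zero]

/-- On `F²` the map `F → L/L² ∧ L/L²` has kernel in `[S, F]`, with `S` the preimage of `L²`. -/
theorem mem_of_wedgeMap_eq_zero (hπ : Function.Surjective π)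
    {θ : FreeLieAlgebra k X →ₗ[k] ⋀[k]^2 (Ab k L)}
    (hθ : ∀ u v, θ ⁅u, v⁆ = wedge k (Ab k L) (abMap k L (π u)) (abMap k L (π v)))
    {w : FreeLieAlgebra k X} (hw : w ∈ derived k (FreeLieAlgebra k X)) (h0 : θ w = 0) :
    w ∈ ⁅preDerived π, (⊤ : LieIdeal k (FreeLieAlgebra k X))⁆ := by
  let P : FreeLieAlgebra k X →ₗ[k] Ab k L := abMap k L ∘ₗ (π : FreeLieAlgebra k X →ₗ[k] L)
  obtain ⟨s, hs⟩ := LinearMap.exists_rightInverse_of_surjective P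
    (LinearMap.range_eq_top.2 (abMap_surjective.comp hπ))
  have hs' : ∀ a, P (s a) = a := fun a => LinearMap.congr_fun hs a
  let J : Submodule k (FreeLieAlgebra k X) :=
    (⁅preDerived π, (⊤ : LieIdeal k (FreeLieAlgebra k X))⁆).toSubmodule
  let br : FreeLieAlgebra k X →ₗ[k] FreeLieAlgebra k X →ₗ[k] FreeLieAlgebra k X :=
    (LieAlgebra.ad k (FreeLieAlgebra k X) :
      FreeLieAlgebra k X →ₗ[k] Module.End k (FreeLieAlgebra k X))
  -- A map back, `a ∧ b ↦ [s a, s b]` modulo `[S, F]`: changing a lift by an element of `S` does not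
  -- affect the class. On `F²`, `γ ∘ θ` is the quotient map, so `θ w = 0` forces `w ∈ [S, F]`.
  obtain ⟨γ, hγ⟩ := exists_wedge_lift k ((br.compl₁₂ s s).compr₂ J.mkQ) (fun a => by
    change J.mkQ ⁅s a, s a⁆ = 0
    rw [lie_self, map_zero])
  have hdiff : ∀ u, s (P u) - u ∈ preDerived π := fun u => by
    rw [mem_preDerived, ← abMap_eq_zero]
    change P (s (P u) - u) = 0
    rw [map_sub, hs', sub_self]
  have hJ : ∀ u ∈ preDerived π, ∀ v, ⁅u, v⁆ ∈ J := fun u hu v =>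
    LieSubmodule.lie_mem_lie hu (LieSubmodule.mem_top v)
  have key : γ (θ w) = J.mkQ w := by
    refine derived_le (S := LinearMap.eqLocus (γ ∘ₗ θ) J.mkQ) (fun u v => ?_) hw
    change γ (θ ⁅u, v⁆) = J.mkQ ⁅u, v⁆
    rw [hθ, hγ]
    change J.mkQ ⁅s (P u), s (P v)⁆ = J.mkQ ⁅u, v⁆
    rw [← sub_eq_zero, ← map_sub]
    refine (Submodule.Quotient.mk_eq_zero _).2 ?_
    have e : ⁅s (P u), s (P v)⁆ - ⁅u, v⁆ = ⁅s (P u) - u, s (P v)⁆ - ⁅s (P v) - v, u⁆ := by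
      rw [sub_lie, sub_lie, ← lie_skew u v, ← lie_skew u (s (P v))]
      abel
    rw [e]
    exact sub_mem (hJ _ (hdiff u) _) (hJ _ (hdiff v) _)
  rw [h0, map_zero] at key
  exact (Submodule.Quotient.mk_eq_zero _).1 key.symm

/-- Both sides agree on brackets, which span `F²`. This is why, for `w ∈ F²`, `w ∈ R` is equivalent
to `θ w ∈ ker ρ`. -/
theorem rho_wedgeMap (hL : LieModule.nilpotencyLength L L = 2)
    {θ : FreeLieAlgebra k X →ₗ[k] ⋀[k]^2 (Ab k L)}
    (hθ : ∀ u v, θ ⁅u, v⁆ = wedge k (Ab k L) (abMap k L (π u)) (abMap k L (π v)))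
    {w : FreeLieAlgebra k X} (hw : w ∈ derived k (FreeLieAlgebra k X)) :
    (rho hL (θ w) : L) = π w := by
  refine derived_le (S := LinearMap.eqLocus
    ((derived k L).toSubmodule.subtype ∘ₗ rho hL ∘ₗ θ)
    (π : FreeLieAlgebra k X →ₗ[k] L)) (fun u v => ?_) hw
  change (rho hL (θ ⁅u, v⁆) : L) = π ⁅u, v⁆
  rw [hθ, rho_wedge, LieHom.map_lie]
  rfl

theorem exists_wedgeMap_eq (hπ : Function.Surjective π)
    {θ : FreeLieAlgebra k X →ₗ[k] ⋀[k]^2 (Ab k L)}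
    (hθ : ∀ u v, θ ⁅u, v⁆ = wedge k (Ab k L) (abMap k L (π u)) (abMap k L (π v)))
    (t : ⋀[k]^2 (Ab k L)) : ∃ w ∈ derived k (FreeLieAlgebra k X), θ w = t := by
  have h : (⊤ : Submodule k (⋀[k]^2 (Ab k L))) ≤
      (derived k (FreeLieAlgebra k X)).toSubmodule.map θ := by
    rw [← span_wedge, Submodule.span_le]
    rintro _ ⟨a, b, rfl⟩
    obtain ⟨x, rfl⟩ := abMap_surjective a
    obtain ⟨y, rfl⟩ := abMap_surjective b
    obtain ⟨u, rfl⟩ := hπ x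
    obtain ⟨v, rfl⟩ := hπ y
    exact ⟨⁅u, v⁆, lie_mem_derived u v, hθ u v⟩
  exact h Submodule.mem_top

theorem IsBeta.mem_range {β : derived k L ⊗[k] Ab k L →ₗ[k] SchurMultiplier π} (h : IsBeta π β)
    (hL : LieModule.nilpotencyLength L L = 2) (w : relDerived π)
    (hw : (w : FreeLieAlgebra k X) ∈ ⁅preDerived π, (⊤ : LieIdeal k (FreeLieAlgebra k X))⁆) :
    schurMk π w ∈ LinearMap.range β := by
  let T : Submodule k (FreeLieAlgebra k X) :=
    ((LinearMap.range β).comap (schurMk π)).map (relDerived π).toSubmodule.subtype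
  have hT : (⁅preDerived π, (⊤ : LieIdeal k (FreeLieAlgebra k X))⁆).toSubmodule ≤ T := by
    rw [LieSubmodule.lieIdeal_oper_eq_linear_span', Submodule.span_le]
    rintro _ ⟨u, hu, v, -, rfl⟩
    exact ⟨⟨⁅u, v⁆, lie_mem_relDerived hL hu v⟩, ⟨_, h.apply hL hu v⟩, rfl⟩
  obtain ⟨w', hw', e⟩ := hT hw
  rwa [Subtype.ext (a1 := w') (a2 := w) e] at hw'

/-! ### The splitting of the Schur multiplier -/

/-- The Schur multiplier is the direct sum of `ker ρ` and `(L² ⊗ L/L²)/K`, compatibly with `β`. -/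
theorem exists_schurSplit (hL : LieModule.nilpotencyLength L L = 2) (hπ : Function.Surjective π)
    {β : derived k L ⊗[k] Ab k L →ₗ[k] SchurMultiplier π} (h : IsBeta π β) :
    ∃ (θ : SchurMultiplier π →ₗ[k] ⋀[k]^2 (Ab k L))
      (φ : SchurMultiplier π →ₗ[k] (derived k L ⊗[k] Ab k L) ⧸ jacobiSpan k L),
      φ ∘ₗ β = (jacobiSpan k L).mkQ ∧ LinearMap.range β = LinearMap.ker θ ∧
        LinearMap.range θ = LinearMap.ker (rho (k := k) hL) := by
  obtain ⟨φ, hφR, hφ⟩ := exists_tensorMap π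
  obtain ⟨θ, hθ⟩ := exists_wedgeMap π
  obtain ⟨φ', hφ'⟩ := exists_schur_lift φ hφR
  obtain ⟨θ', hθ'⟩ := exists_schur_lift (π := π) θ (fun u v hu => by
    rw [hθ, hu, map_zero, map_zero, LinearMap.zero_apply])
  have hβ : ∀ (x : derived k L) (a : Ab k L), ∃ (u v : FreeLieAlgebra k X)
      (hu : u ∈ preDerived π), x = ⟨π u, (mem_preDerived π).1 hu⟩ ∧ a = abMap k L (π v) := by
    intro x a
    obtain ⟨z, rfl⟩ := abMap_surjective a
    obtain ⟨v, rfl⟩ := hπ z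
    obtain ⟨u, hu⟩ := hπ x
    exact ⟨u, v, (mem_preDerived π).2 (hu ▸ x.2), Subtype.ext hu.symm, rfl⟩
  refine ⟨θ', φ', TensorProduct.ext' fun x a => ?_, le_antisymm ?_ fun m hm => ?_,
    le_antisymm ?_ fun t ht => ?_⟩
  · obtain ⟨u, v, hu, rfl, rfl⟩ := hβ x a
    rw [LinearMap.comp_apply, h.apply hL hu v, hφ']
    exact hφ u v hu
  · rw [LinearMap.range_le_ker_iff]
    refine TensorProduct.ext' fun x a => ?_
    obtain ⟨u, v, hu, rfl, rfl⟩ := hβ x a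
    rw [LinearMap.comp_apply, h.apply hL hu v, hθ', LinearMap.zero_apply]
    change θ ⁅u, v⁆ = 0
    rw [hθ, abMap_eq_zero.2 ((mem_preDerived π).1 hu), map_zero, LinearMap.zero_apply]
  · obtain ⟨w, rfl⟩ := schurMk_surjective m
    rw [LinearMap.mem_ker, hθ'] at hm
    exact h.mem_range hL w (mem_of_wedgeMap_eq_zero hπ hθ w.2.2 hm)
  · rintro _ ⟨m, rfl⟩
    obtain ⟨w, rfl⟩ := schurMk_surjective m
    rw [hθ', LinearMap.mem_ker]
    exact Subtype.ext ((rho_wedgeMap hL hθ w.2.2).trans (mem_ker_iff.1 w.2.1))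
  · obtain ⟨w, hw, rfl⟩ := exists_wedgeMap_eq hπ hθ t
    have h0 : π w = 0 := by
      rw [← rho_wedgeMap hL hθ hw, LinearMap.mem_ker.1 ht]
      rfl
    exact ⟨schurMk π ⟨w, mem_ker_iff.2 h0, hw⟩, hθ' _⟩

theorem IsBeta.ker_eq (hL : LieModule.nilpotencyLength L L = 2) (hπ : Function.Surjective π)
    {β : derived k L ⊗[k] Ab k L →ₗ[k] SchurMultiplier π} (h : IsBeta π β) :
    LinearMap.ker β = jacobiSpan k L := by
  obtain ⟨_, φ, hφ, -, -⟩ := exists_schurSplit hL hπ h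
  refine le_antisymm ?_ (h.jacobiSpan_le hπ)
  calc LinearMap.ker β ≤ LinearMap.ker (φ ∘ₗ β) := LinearMap.ker_le_ker_comp β φ
    _ = jacobiSpan k L := by rw [hφ, Submodule.ker_mkQ]

theorem nonempty_schur_equiv_modelM (hL : LieModule.nilpotencyLength L L = 2)
    (hπ : Function.Surjective π) :
    Nonempty (SchurMultiplier π ≃ₗ[k] modelM (k := k) hL) := by
  obtain ⟨β, h⟩ := exists_isBeta hL hπ
  obtain ⟨θ, φ, hφ, hker, hrange⟩ := exists_schurSplit hL hπ h
  have hφ' : ∀ t, φ (β t) = (jacobiSpan k L).mkQ t := fun t => LinearMap.congr_fun hφ t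
  have hθβ : ∀ t, θ (β t) = 0 := fun t =>
    LinearMap.mem_ker.1 (hker ▸ LinearMap.mem_range_self β t)
  let Ψ : SchurMultiplier π →ₗ[k] MStar k L :=
    (AbelianLie.toSpace k).symm.toLinearMap ∘ₗ θ.prod φ
  have hmem : ∀ m, Ψ m ∈ (modelM (k := k) hL).toSubmodule := fun m => by
    change θ m ∈ LinearMap.ker (rho hL)
    rw [← hrange]
    exact LinearMap.mem_range_self θ m
  refine ⟨LinearEquiv.ofBijective (LinearMap.codRestrict _ Ψ hmem) ⟨?_, ?_⟩⟩
  · rw [← LinearMap.ker_eq_bot, LinearMap.ker_codRestrict, LinearMap.ker_eq_bot']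
    intro m hm
    have h1 : θ m = 0 := congrArg Prod.fst hm
    have h2 : φ m = 0 := congrArg Prod.snd hm
    -- Now `m = β t`, and `φ (β t) = 0` puts `t` in `K`, which `β` kills.
    obtain ⟨t, rfl⟩ : m ∈ LinearMap.range β := hker ▸ LinearMap.mem_ker.2 h1
    rw [hφ'] at h2
    exact h.jacobiSpan_le hπ ((Submodule.Quotient.mk_eq_zero _).1 h2)
  · rintro ⟨⟨a, q⟩, ha⟩
    obtain ⟨m, hm⟩ : a ∈ LinearMap.range θ := hrange ▸ ha
    -- Adding `β t` corrects the second coordinate to `q` without changing the first, since `θ ∘ β =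
    -- 0`.
    obtain ⟨t, ht⟩ := Submodule.mkQ_surjective _ (q - φ m)
    refine ⟨m + β t, Subtype.ext (Prod.ext ?_ ?_)⟩
    · change θ (m + β t) = a
      rw [map_add, hθβ, add_zero, hm]
    · change φ (m + β t) = q
      rw [map_add, hφ', ht, add_sub_cancel]

end Presentation

/-! ### The subalgebras `M` and their dimension -/

section Model

variable {k L : Type*} [Field k] [LieRing L] [LieAlgebra k L]

theorem idealN_le_modelM (hL : LieModule.nilpotencyLength L L = 2) :
    (idealN k L).toSubmodule ≤ (modelM (k := k) hL).toSubmodule := by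
  intro m hm
  have hm' : wedgePart k L m = 0 := hm
  change rho hL (wedgePart k L m) = 0
  rw [hm', map_zero]

/-- The projection `M → ker ρ`. -/
def modelMProj (hL : LieModule.nilpotencyLength L L = 2) :
    modelM (k := k) hL →ₗ[k] LinearMap.ker (rho (k := k) hL) :=
  (wedgePart k L ∘ₗ (modelM (k := k) hL).toSubmodule.subtype).codRestrict _ fun m => m.2

theorem modelMProj_surjective (hL : LieModule.nilpotencyLength L L = 2) :
    Function.Surjective (modelMProj (k := k) hL) := fun t =>
  ⟨⟨((AbelianLie.toSpace k).symm
    ((t : ⋀[k]^2 (Ab k L)), (0 : (derived k L ⊗[k] Ab k L) ⧸ jacobiSpan k L))), t.2⟩,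
    Subtype.ext rfl⟩

theorem mem_comap_idealN_iff (hL : LieModule.nilpotencyLength L L = 2) (m : modelM (k := k) hL) :
    m ∈ LieIdeal.comap (modelM (k := k) hL).incl (idealN k L) ↔ modelMProj hL m = 0 :=
  LieIdeal.mem_comap.trans (Subtype.ext_iff (a1 := modelMProj hL m) (a2 := 0)).symm

theorem isModel_modelM (hL : LieModule.nilpotencyLength L L = 2) :
    IsModel (k := k) hL (modelM hL) :=
  ⟨idealN_le_modelM hL, nonempty_quotient_equiv (fun _ _ => rfl) _ (modelMProj hL)
    (modelMProj_surjective hL) (mem_comap_idealN_iff hL)⟩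

instance [FiniteDimensional k L] : FiniteDimensional k (MStar k L) :=
  inferInstanceAs (FiniteDimensional k
    ((⋀[k]^2 (Ab k L)) × ((derived k L ⊗[k] Ab k L) ⧸ jacobiSpan k L)))

/-- The quotient by `N` has the dimension of `ker ρ`, and `N ⊆ M` makes the pullback of `N` to `M` a
full copy of `N`. The right side does not involve `M`, so all models have equal dimension. -/
theorem IsModel.finrank_eq [FiniteDimensional k L] {hL : LieModule.nilpotencyLength L L = 2}
    {M : LieSubalgebra k (MStar k L)} (h : IsModel hL M) :
    Module.finrank k M = Module.finrank k (LinearMap.ker (rho (k := k) hL)) +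
      Module.finrank k (idealN k L).toSubmodule := by
  obtain ⟨hle, ⟨e⟩⟩ := h
  let N' : Submodule k M := (LieIdeal.comap M.incl (idealN k L)).toSubmodule
  have e1 : Module.finrank k (M ⧸ N') = Module.finrank k (LinearMap.ker (rho (k := k) hL)) :=
    (e.toLinearEquiv.trans (AbelianLie.toSpace k)).finrank_eq
  have e2 : Module.finrank k N' = Module.finrank k (idealN k L).toSubmodule :=
    (Submodule.comapSubtypeEquivOfLe hle).finrank_eq
  rw [← e1, ← e2]
  exact (Submodule.finrank_quotient_add_finrank N').symm

end Model

end ClassTwo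

end

theorem mainTheorem4 {k : Type*} [Field k] {L : Type*} [LieRing L] [LieAlgebra k L]
    [FiniteDimensional k L] (hL : LieModule.nilpotencyLength L L = 2)
    {X : Type*} (π : FreeLieAlgebra k X →ₗ⁅k⁆ L) (hπ : Function.Surjective π) :
    ClassTwo.IsModel (k := k) hL (ClassTwo.modelM hL) ∧
    (∀ M : LieSubalgebra k (ClassTwo.MStar k L), ClassTwo.IsModel hL M →
      Nonempty (ClassTwo.SchurMultiplier π ≃ₗ⁅k⁆ M)) ∧
    (∃! β : ClassTwo.derived k L ⊗[k] ClassTwo.Ab k L →ₗ[k] ClassTwo.SchurMultiplier π,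
      ClassTwo.IsBeta π β) ∧
    (∀ β : ClassTwo.derived k L ⊗[k] ClassTwo.Ab k L →ₗ[k] ClassTwo.SchurMultiplier π,
      ClassTwo.IsBeta π β → LinearMap.ker β = ClassTwo.jacobiSpan k L) := by
  obtain ⟨β, hβ⟩ := ClassTwo.exists_isBeta hL hπ
  refine ⟨ClassTwo.isModel_modelM hL, fun M hM => ?_,
    ⟨β, hβ, fun _ h => ClassTwo.IsBeta.unique hπ h hβ⟩,
    fun _ h => ClassTwo.IsBeta.ker_eq hL hπ h⟩
  obtain ⟨e⟩ := ClassTwo.nonempty_schur_equiv_modelM (k := k) hL hπ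
  -- An arbitrary `M` need not equal `modelM`, but the dimensions agree and all brackets vanish, so
  -- any linear isomorphism between the two respects brackets.
  have hrank := (ClassTwo.isModel_modelM (k := k) hL).finrank_eq.trans hM.finrank_eq.symm
  exact ⟨ClassTwo.lieEquivOfAbelian ClassTwo.schur_lie_eq_zero (fun _ _ => rfl)
    (e.trans (LinearEquiv.ofFinrankEq _ _ hrank))⟩
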